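/- Let $m\ge 2$ be an integer. For a profinite group $G$ write $H^2(G)=H^2(G,\mathbb Z/m)$ for the second continuous (profinite) cohomology group with trivial action on the discrete group $\mathbb Z/m$. Let $\Omega$ be a non-empty set of central extensions of profinite groups $$\omega:\quad 0\to \mathbb Z/m\to \mathbb U_\omega\xrightarrow{\lambda_\omega}\bar{\mathbb U}_\omega\to 1 ,$$ such that for every $\omega\in\Omega$: (I) there are finitely many continuous homomorphisms $\gamma_i\colon\bar{\mathbb U}_\omega\to\mathbb U_\omega$, $i=1,\dots,n$, with $\bigcap_{i=1}^n\ker\gamma_i=\{1\}$; (II) $\mathbb Z/m$ embeds in $\bar{\mathbb U}_\omega$. Let $\alpha_\omega\in H^2(\bar{\mathbb U}_\omega)$ be the classifying element of $\omega$, i.e. the class of the factor set of a continuous section of $\lambda_\omega$. For a profinite group $G$, let $T(G)$ (resp. $\bar T(G)$) be the intersection of the kernels of all continuous homomorphisms $G\to\mathbb U_\omega$ (resp. $G\to\bar{\mathbb U}_\omega$), with $\omega$ ranging over $\Omega$. Let $N$ be a closed normal subgroup of a profinite group $G$ with $N\le\bar T(G)$, and let $\pi\colon G\to G/N$ be the natural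 projection. A continuous homomorphism $\bar\rho\colon G/N\to\bar{\mathbb U}_\omega$, $\omega\in\Omega$, is called $\pi$-liftable if there is a continuous homomorphism $\rho\colon G\to\mathbb U_\omega$ (a lifting of $\bar\rho$) with $\lambda_\omega\circ\rho=\bar\rho\circ\pi$. Let $H^2(G/N)_\pi$ be the subgroup of $H^2(G/N)$ generated by all pullbacks $\bar\rho^*(\alpha_\omega)$ with $\omega\in\Omega$ and $\bar\rho\colon G/N\to\bar{\mathbb U}_\omega$ a $\pi$-liftable continuous homomorphism. Then: (a) There is a bilinear map, continuous in the first variable, $$\langle\cdot,\cdot\rangle\colon\ N/(N\cap T(G))\times H^2(G/N)_\pi\to\mathbb Z/m$$ which is non-degenerate (its left and right kernels are both trivial), and which satisfies $\langle \sigma (N\cap T(G)),\bar\rho^*(\alpha_\omega)\rangle=\rho(\sigma)$ for every $\sigma\in N$, every $\omega\in\Omega$, every $\pi$-liftable continuous homomorphism $\bar\rho\colon G/N\to\bar{\mathbb U}_\omega$ and every lifting $\rho$ of $\bar\rho$ (here $\rho(\sigma)\in\ker\lambda_\omega=\mathbb Z/m$). (b) If $m=p$ is prime, the sequence $$0\to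 H^2(G/N)_\pi\to H^2(G/N)\xrightarrow{\ \inf\ }H^2\bigl(G/(N\cap T(G))\bigr),$$ in which the second map is the inclusion, is exact. -/

import Mathlib

universe u v

/-! ### Continuous cohomology in degree two with coefficients in `ℤ/m` (trivial action) -/

section Cohomology

/-- Continuous (inhomogeneous) `2`-cocycles of `G` with values in the discrete group `ℤ/m`, on which
`G` acts trivially. -/
def contCocycles₂ (m : ℕ) (G : Type*) [Group G] [TopologicalSpace G] :
    AddSubgroup C(G × G, ZMod m) where
  carrier := {f | ∀ x y z : G, f (y, z) - f (x * y, z) + f (x, y * z) - f (x, y) = 0}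
  zero_mem' := by intro x y z; simp
  add_mem' := by
    intro f g hf hg x y z
    have h := congrArg₂ (· + ·) (hf x y z) (hg x y z)
    simp only [add_zero] at h
    simp only [ContinuousMap.add_apply]
    rw [← h]; ring
  neg_mem' := by
    intro f hf x y z
    have h := congrArg Neg.neg (hf x y z)
    simp only [neg_zero] at h
    simp only [ContinuousMap.neg_apply]
    rw [← h]; ring

/-- The coboundary `(∂b)(x, y) = b(y) - b(xy) + b(x)` of a continuous `1`-cochain. -/
def contCoboundary₁ (m : ℕ) (G : Type*) [Group G] [TopologicalSpace G] [ContinuousMul G] :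
    C(G, ZMod m) →+ contCocycles₂ m G where
  toFun b := ⟨⟨fun q ↦ b q.2 - b (q.1 * q.2) + b q.1, by fun_prop⟩, by
    intro x y z
    simp only [ContinuousMap.coe_mk, mul_assoc]
    ring⟩
  map_zero' := by ext; simp
  map_add' a b := by
    ext q
    simp only [ContinuousMap.add_apply, ContinuousMap.coe_mk, AddSubgroup.coe_add]
    ring

/-- `H²(G) = H²(G, ℤ/m)`: continuous `2`-cocycles modulo coboundaries of continuous `1`-cochains. -/
abbrev ContH2 (m : ℕ) (G : Type*) [Group G] [TopologicalSpace G] [ContinuousMul G] : Type _ :=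
  contCocycles₂ m G ⧸ (contCoboundary₁ m G).range

/-- Pullback of continuous `2`-cocycles along a continuous homomorphism. -/
def contCocyclesMap (m : ℕ) {G H : Type*} [Group G] [TopologicalSpace G]
    [Group H] [TopologicalSpace H] (φ : G →ₜ* H) : contCocycles₂ m H →+ contCocycles₂ m G where
  toFun f := ⟨⟨fun q ↦ f.1 (φ q.1, φ q.2), by fun_prop⟩, by
    intro x y z
    simpa only [ContinuousMap.coe_mk, map_mul] using f.2 (φ x) (φ y) (φ z)⟩
  map_zero' := by ext; simp
  map_add' a b := by ext q; simp

/-- The homomorphism `φ^* : H²(H) → H²(G)` induced by a continuous homomorphism `φ : G → H`. -/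
def ContH2.map (m : ℕ) {G H : Type*} [Group G] [TopologicalSpace G] [ContinuousMul G]
    [Group H] [TopologicalSpace H] [ContinuousMul H] (φ : G →ₜ* H) :
    ContH2 m H →+ ContH2 m G :=
  QuotientAddGroup.map _ _ (contCocyclesMap m φ) (by
    rintro _ ⟨b, rfl⟩
    refine ⟨b.comp ⟨φ, φ.continuous_toFun⟩, ?_⟩
    ext q
    simp [contCoboundary₁, contCocyclesMap])

end Cohomology

/-- The natural projection `G/N₁ → G/N₂` for normal subgroups `N₁ ≤ N₂`. -/
def quotientProj {G : Type*} [Group G] [TopologicalSpace G] (N₁ N₂ : Subgroup G)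
    [N₁.Normal] [N₂.Normal] (h : N₁ ≤ N₂) : G ⧸ N₁ →ₜ* G ⧸ N₂ where
  toMonoidHom := QuotientGroup.map N₁ N₂ (MonoidHom.id G) h
  continuous_toFun := by
    refine (QuotientGroup.isQuotientMap_mk (N := N₁)).continuous_iff.2 ?_
    exact QuotientGroup.continuous_mk

/-- The inflation homomorphism `H²(G/N₂) → H²(G/N₁)` for normal subgroups `N₁ ≤ N₂`. -/
def inflation (m : ℕ) {G : Type*} [Group G] [TopologicalSpace G] [IsTopologicalGroup G]
    (N₁ N₂ : Subgroup G) [N₁.Normal] [N₂.Normal] (h : N₁ ≤ N₂) :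
    ContH2 m (G ⧸ N₂) →+ ContH2 m (G ⧸ N₁) :=
  ContH2.map m (quotientProj N₁ N₂ h)

/-! ### Central extensions of profinite groups by `ℤ/m` -/

/-- A central extension `0 → ℤ/m → U → Ubar → 1` of profinite groups. (For `m ≥ 1` the map `ι` is
automatically continuous, `ℤ/m` being discrete.) -/
structure ProfiniteCentralExtension (m : ℕ) where
  /-- The middle group. -/
  U : ProfiniteGrp.{u}
  /-- The quotient group. -/
  Ubar : ProfiniteGrp.{u}
  /-- The inclusion of the kernel. -/
  ι : Multiplicative (ZMod m) →* U
  /-- The projection. -/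
  lam : U →ₜ* Ubar
  ι_injective : Function.Injective ι
  lam_surjective : Function.Surjective lam
  range_ι : ι.range = lam.toMonoidHom.ker
  ι_central : ι.range ≤ Subgroup.center U

namespace ProfiniteCentralExtension

variable {m : ℕ} (ω : ProfiniteCentralExtension.{u} m)

/-- There are finitely many continuous homomorphisms `Ubar → U` whose kernels intersect
trivially. -/
def HasSeparatingHoms : Prop :=
  ∃ (n : ℕ) (γ : Fin n → (ω.Ubar →ₜ* ω.U)), ⨅ i, (γ i).toMonoidHom.ker = ⊥

/-- The kernel `ℤ/m` embeds in `Ubar`. -/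
def KernelEmbeds : Prop :=
  ∃ j : Multiplicative (ZMod m) →* ω.Ubar, Function.Injective j

/-- `f` is the factor set of the extension with respect to the continuous section `s` of `lam`,
that is, `s(x) s(y) = f(x, y) s(xy)`. -/
def IsFactorSet (s : C(ω.Ubar, ω.U)) (f : contCocycles₂ m ω.Ubar) : Prop :=
  (∀ x, ω.lam (s x) = x) ∧
    ∀ x y, s x * s y = ω.ι (Multiplicative.ofAdd (f.1 (x, y))) * s (x * y)

theorem commute_ι (z : Multiplicative (ZMod m)) (x : ω.U) : x * ω.ι z = ω.ι z * x :=
  Subgroup.mem_center_iff.1 (ω.ι_central ⟨z, rfl⟩) x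

theorem lam_ι (z : Multiplicative (ZMod m)) : ω.lam (ω.ι z) = 1 := by
  have h : ω.ι z ∈ ω.lam.toMonoidHom.ker := ω.range_ι ▸ ⟨z, rfl⟩
  exact h

theorem exists_ι_of_lam_eq_one {x : ω.U} (hx : ω.lam x = 1) : ∃ z, ω.ι z = x := by
  have h : x ∈ ω.ι.range := ω.range_ι ▸ (show x ∈ ω.lam.toMonoidHom.ker from hx)
  exact h

theorem isQuotientMap_lam : Topology.IsQuotientMap ω.lam :=
  ω.lam.continuous_toFun.isClosedMap.isQuotientMap ω.lam.continuous_toFun ω.lam_surjective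

theorem isClosedEmbedding_ι [NeZero m] : Topology.IsClosedEmbedding ω.ι := by
  have : DiscreteTopology (Multiplicative (ZMod m)) :=
    inferInstanceAs (DiscreteTopology (ZMod m))
  have : Finite (Multiplicative (ZMod m)) := inferInstanceAs (Finite (ZMod m))
  exact continuous_of_discreteTopology.isClosedEmbedding ω.ι_injective

theorem exists_continuous_section [NeZero m] :
    ∃ s : C(ω.Ubar, ω.U), ∀ x, ω.lam (s x) = x := by
  have : Finite (Multiplicative (ZMod m)) := inferInstanceAs (Finite (ZMod m))
  obtain ⟨H, hH⟩ := ProfiniteGrp.exist_openNormalSubgroup_sub_open_nhds_of_one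
    (G := ω.U) (U := (Set.range ω.ι \ {1})ᶜ)
    ((Set.finite_range ω.ι).subset Set.sdiff_subset).isClosed.isOpen_compl (by simp)
  have hH1 : ∀ z, ω.ι z ∈ (H : Set ω.U) → z = 1 := by
    intro z hz
    by_contra h1
    refine hH hz ⟨⟨z, rfl⟩, ?_⟩
    simpa using fun h ↦ h1 (ω.ι_injective (h.trans (map_one _).symm))
  let K : Subgroup ω.U := H.toSubgroup ⊔ ω.ι.range
  have hc : ∀ u : ω.U, ∃ z, ((u : ω.U ⧸ K).out)⁻¹ * u * (ω.ι z)⁻¹ ∈ H.toSubgroup := by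
    intro u
    have h : ((u : ω.U ⧸ K).out)⁻¹ * u ∈ K :=
      QuotientGroup.eq.1 (QuotientGroup.out_eq' (u : ω.U ⧸ K))
    obtain ⟨h', hh', _, ⟨z, rfl⟩, e⟩ := Subgroup.mem_sup_of_normal_left.1 h
    exact ⟨z, by rw [← e]; simpa using hh'⟩
  choose c hc using hc
  have huniq : ∀ (t : ω.U) (z z' : Multiplicative (ZMod m)),
      t * (ω.ι z)⁻¹ ∈ H.toSubgroup → t * (ω.ι z')⁻¹ ∈ H.toSubgroup → z = z' := by
    intro t z z' h h'
    have h2 := H.toSubgroup.mul_mem (H.toSubgroup.inv_mem h) h'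
    have e : (t * (ω.ι z)⁻¹)⁻¹ * (t * (ω.ι z')⁻¹) = ω.ι (z * z'⁻¹) := by
      rw [map_mul, map_inv]; group
    rw [e] at h2
    exact mul_inv_eq_one.1 (hH1 _ h2)
  have hloc : ∀ u h, h ∈ H.toSubgroup → c (u * h) = c u := by
    intro u h hh
    have e : ((u * h : ω.U) : ω.U ⧸ K) = (u : ω.U ⧸ K) := by
      refine (QuotientGroup.eq.2 ?_).symm
      simpa using (le_sup_left : H.toSubgroup ≤ K) hh
    have h1 := hc (u * h)
    rw [e] at h1
    refine huniq _ _ _ h1 ?_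
    have h2 := H.toSubgroup.mul_mem (hc u) hh
    convert h2 using 1
    have := ω.commute_ι (c u)⁻¹ h
    rw [map_inv] at this
    simp only [mul_assoc, this]
  have htrans : ∀ u z, c (u * ω.ι z) = c u * z := by
    intro u z
    have e : ((u * ω.ι z : ω.U) : ω.U ⧸ K) = (u : ω.U ⧸ K) := by
      refine (QuotientGroup.eq.2 ?_).symm
      simpa using (le_sup_right : ω.ι.range ≤ K) ⟨z, rfl⟩
    have h1 := hc (u * ω.ι z)
    rw [e] at h1
    refine huniq _ _ _ h1 ?_
    convert hc u using 1
    rw [map_mul]; group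
  have hcont : Continuous c := by
    let _ : TopologicalSpace (Multiplicative (ZMod m)) := ⊥
    refine IsLocallyConstant.continuous ((IsLocallyConstant.iff_exists_open _).2 fun u ↦
      ⟨(fun x ↦ u⁻¹ * x) ⁻¹' (H : Set ω.U), H.isOpen'.preimage (by fun_prop), ?_, ?_⟩)
    · simp
    · intro x hx
      have := hloc u (u⁻¹ * x) hx
      simpa using this
  let F : ω.U → ω.U := fun u ↦ u * (ω.ι (c u))⁻¹
  have hF : Continuous F :=
    continuous_id.mul (ω.isClosedEmbedding_ι.continuous.comp hcont).inv
  have hFlam : ∀ u u', ω.lam u = ω.lam u' → F u = F u' := by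
    intro u u' h
    obtain ⟨z, hz⟩ := ω.exists_ι_of_lam_eq_one (x := u⁻¹ * u') (by simp [h])
    have hu : u' = u * ω.ι z := by rw [hz]; group
    simp only [F, hu, htrans, map_mul]
    group
  have hlamF : ∀ u, ω.lam (F u) = ω.lam u := by
    intro u
    simp [F, lam_ι]
  let s : ω.Ubar → ω.U := fun x ↦ F (Function.surjInv ω.lam_surjective x)
  have hs : s ∘ ω.lam = F := by
    funext u
    exact hFlam _ _ (Function.surjInv_eq ω.lam_surjective _)
  refine ⟨⟨s, ω.isQuotientMap_lam.continuous_iff.2 (hs ▸ hF)⟩, fun x ↦ ?_⟩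
  exact (hlamF _).trans (Function.surjInv_eq ω.lam_surjective _)

theorem exists_factorSet [NeZero m] (s : C(ω.Ubar, ω.U)) (hs : ∀ x, ω.lam (s x) = x) :
    ∃ f, ω.IsFactorSet s f := by
  have h : ∀ q : ω.Ubar × ω.Ubar, ∃ z, ω.ι z = s q.1 * s q.2 * (s (q.1 * q.2))⁻¹ := fun q ↦
    ω.exists_ι_of_lam_eq_one (by simp [hs])
  choose f hf using h
  have hcont : Continuous f := by
    refine ω.isClosedEmbedding_ι.isInducing.continuous_iff.2 ?_
    have e : ω.ι ∘ f = fun q ↦ s q.1 * s q.2 * (s (q.1 * q.2))⁻¹ := funext hf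
    rw [e]; fun_prop
  have hmul : ∀ x y, s x * s y = ω.ι (f (x, y)) * s (x * y) := fun x y ↦ by
    rw [hf]; group
  refine ⟨⟨⟨fun q ↦ (f q).toAdd, continuous_toAdd.comp hcont⟩, ?_⟩, hs, hmul⟩
  intro x y z
  have key : f (x, y) * f (x * y, z) = f (y, z) * f (x, y * z) := by
    apply ω.ι_injective
    apply mul_right_cancel (b := s (x * y * z))
    have h1 : s x * s y * s z = ω.ι (f (x, y) * f (x * y, z)) * s (x * y * z) := by
      rw [hmul, mul_assoc, hmul, map_mul ω.ι]; simp only [mul_assoc]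
    have h2 : s x * (s y * s z) = ω.ι (f (y, z) * f (x, y * z)) * s (x * y * z) := by
      rw [hmul, ← mul_assoc, ω.commute_ι, mul_assoc, hmul, map_mul ω.ι, mul_assoc, mul_assoc x]
    rw [← h1, ← h2, mul_assoc]
  have key' := congrArg Multiplicative.toAdd key
  simp only [toAdd_mul] at key'
  change (f (y, z)).toAdd - (f (x * y, z)).toAdd + (f (x, y * z)).toAdd - (f (x, y)).toAdd = 0
  linear_combination -key'

theorem exists_isFactorSet [NeZero m] : ∃ f, ∃ s, ω.IsFactorSet s f := by
  obtain ⟨s, hs⟩ := ω.exists_continuous_section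
  obtain ⟨f, hf⟩ := ω.exists_factorSet s hs
  exact ⟨f, s, hf⟩

/-- The classifying element `α_ω ∈ H²(Ubar)` of the extension: the class of the factor set of a
continuous section. It does not depend on the section, see `alpha_eq`. -/
noncomputable def alpha [NeZero m] : ContH2 m ω.Ubar :=
  QuotientAddGroup.mk ω.exists_isFactorSet.choose

theorem mk_eq_mk_of_isFactorSet [NeZero m] {s s' : C(ω.Ubar, ω.U)} {f f' : contCocycles₂ m ω.Ubar}
    (h : ω.IsFactorSet s f) (h' : ω.IsFactorSet s' f') :
    (QuotientAddGroup.mk f : ContH2 m ω.Ubar) = QuotientAddGroup.mk f' := by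
  have hb : ∀ x, ∃ z, ω.ι z = s' x * (s x)⁻¹ := fun x ↦
    ω.exists_ι_of_lam_eq_one (by simp [h.1, h'.1])
  choose b hb using hb
  have hcont : Continuous b := by
    refine ω.isClosedEmbedding_ι.isInducing.continuous_iff.2 ?_
    have e : ω.ι ∘ b = fun x ↦ s' x * (s x)⁻¹ := funext hb
    rw [e]; fun_prop
  have hs' : ∀ x, s' x = ω.ι (b x) * s x := fun x ↦ by rw [hb]; group
  refine QuotientAddGroup.eq.2 ⟨⟨fun x ↦ (b x).toAdd, continuous_toAdd.comp hcont⟩, ?_⟩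
  ext ⟨x, y⟩
  have key : b x * b y * .ofAdd (f.1 (x, y)) = .ofAdd (f'.1 (x, y)) * b (x * y) := by
    apply ω.ι_injective
    apply mul_right_cancel (b := s (x * y))
    have h1 : s' x * s' y = ω.ι (b x * b y * .ofAdd (f.1 (x, y))) * s (x * y) := by
      rw [hs', hs', map_mul ω.ι, map_mul ω.ι, mul_assoc (ω.ι (b x) * _), ← h.2 x y, ← mul_assoc,
        mul_assoc (ω.ι (b x)), ω.commute_ι]
      simp only [mul_assoc]
    rw [← h1, h'.2 x y, hs', map_mul ω.ι, mul_assoc]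
  have key' := congrArg Multiplicative.toAdd key
  simp only [toAdd_mul, toAdd_ofAdd] at key'
  simp only [contCoboundary₁, AddMonoidHom.coe_mk, ZeroHom.coe_mk, ContinuousMap.coe_mk,
    AddSubgroup.coe_add, NegMemClass.coe_neg, ContinuousMap.add_apply, ContinuousMap.neg_apply]
  linear_combination key'

theorem alpha_eq [NeZero m] {s : C(ω.Ubar, ω.U)} {f : contCocycles₂ m ω.Ubar}
    (h : ω.IsFactorSet s f) : ω.alpha = QuotientAddGroup.mk f :=
  ω.mk_eq_mk_of_isFactorSet ω.exists_isFactorSet.choose_spec.choose_spec h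

end ProfiniteCentralExtension

/-! ### The subgroups `T(G)` and `Tbar(G)`, and the liftable part of `H²(G/N)` -/

section Liftable

/-- `T^U(G)`: the intersection of the kernels of all continuous homomorphisms `G → U`. -/
def kernelIntersection (U : Type*) [Group U] [TopologicalSpace U]
    (G : Type*) [Group G] [TopologicalSpace G] : Subgroup G :=
  ⨅ ρ : G →ₜ* U, ρ.toMonoidHom.ker

instance (U : Type*) [Group U] [TopologicalSpace U] (G : Type*) [Group G] [TopologicalSpace G] :
    (kernelIntersection U G).Normal :=
  Subgroup.normal_iInf_normal fun _ ↦ inferInstance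

variable {m : ℕ} (Ω : Set (ProfiniteCentralExtension.{u} m))

/-- `T(G)`, the intersection of all `T^{U_ω}(G)`, `ω ∈ Ω`. -/
def subgroupT (G : Type*) [Group G] [TopologicalSpace G] : Subgroup G :=
  ⨅ ω : Ω, kernelIntersection ω.1.U G

/-- `Tbar(G)`, the intersection of all `T^{Ubar_ω}(G)`, `ω ∈ Ω`. -/
def subgroupTbar (G : Type*) [Group G] [TopologicalSpace G] : Subgroup G :=
  ⨅ ω : Ω, kernelIntersection ω.1.Ubar G

instance (G : Type*) [Group G] [TopologicalSpace G] : (subgroupT Ω G).Normal :=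
  Subgroup.normal_iInf_normal fun _ ↦ inferInstance

/-- `ρ : G → U_ω` is a lifting of `ρbar : G/N → Ubar_ω` with respect to the natural projection
`π : G → G/N`, that is, `lam ∘ ρ = ρbar ∘ π`. -/
def IsLifting {G : Type*} [Group G] [TopologicalSpace G] (N : Subgroup G) [N.Normal]
    (ω : ProfiniteCentralExtension.{u} m) (ρbar : G ⧸ N →ₜ* ω.Ubar) (ρ : G →ₜ* ω.U) : Prop :=
  ∀ g : G, ω.lam (ρ g) = ρbar (g : G ⧸ N)

/-- `H²(G/N)_π`: the subgroup of `H²(G/N)` generated by the pullbacks `ρbar^*(α_ω)`, for `ω ∈ Ω` and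
`ρbar : G/N → Ubar_ω` a continuous homomorphism which is liftable to `G → U_ω`. -/
noncomputable def liftablePart [NeZero m] {G : Type*} [Group G] [TopologicalSpace G]
    [IsTopologicalGroup G] (N : Subgroup G) [N.Normal] : AddSubgroup (ContH2 m (G ⧸ N)) :=
  AddSubgroup.closure {x | ∃ ω ∈ Ω, ∃ ρbar : G ⧸ N →ₜ* ω.Ubar,
    (∃ ρ : G →ₜ* ω.U, IsLifting N ω ρbar ρ) ∧ x = ContH2.map m ρbar ω.alpha}

end Liftable

/-! ### Bilinear maps -/

section Pairing

variable {A B Z : Type*} [Group A] [TopologicalSpace A] [AddCommGroup B] [AddCommGroup Z]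
  [TopologicalSpace Z]

/-- `β : A × B → Z` is biadditive, and continuous in the first variable (`A` is a topological
group, written multiplicatively, and `B` is discrete). -/
def IsBilinearPairing (β : A → B → Z) : Prop :=
  (∀ a a' b, β (a * a') b = β a b + β a' b) ∧ (∀ a b b', β a (b + b') = β a b + β a b') ∧
    ∀ b, Continuous fun a ↦ β a b

/-- The left and the right kernel of `β` are both trivial. -/
def IsNondegeneratePairing (β : A → B → Z) : Prop :=
  (∀ a, (∀ b, β a b = 0) → a = 1) ∧ ∀ b, (∀ a, β a b = 0) → b = 0

end Pairing

/-! The theorem comes from the five-term exact sequence, with transgression kept as a relation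
`IsTransgression` between functions χ on N and classes x in H²(G/N). The relation is additive, and χ
always determines x (`right_unique`). Conversely x determines χ up to restrictions to N of
continuous homomorphisms G → ℤ/m. These restrictions vanish, since ℤ/m embeds in some Ubar_ω and N ≤
Tbar(G), so x determines χ as well (`left_unique`).

If ρ lifts ρbar, the restriction of ρ to N transgresses to ρbar^*(α_ω)
(`IsLifting.exists_isTransgression`). Hence every x in H²(G/N)_π has a unique χ_x, trivial on N ∩
T(G), and the pairing is ⟨σ, x⟩ = χ_x(σ). Its right kernel is trivial because χ_x determines x. Its
left kernel is trivial because N ≤ Tbar(G) makes every ρ : G → U_ω a lifting.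

For (b), the classes killed by inflation to G/(N ∩ T(G)) are the transgressions of characters
trivial on N ∩ T(G). For m prime, linear duality and compactness (`mem_closure_of_forall_eq_zero`)
place such a character in the span of the restrictions of the ρ, hence its transgression in
H²(G/N)_π. -/

/-! ### A relation describing the transgression -/

section Transgression

variable {m : ℕ} {G : Type*} [Group G] [TopologicalSpace G] [IsTopologicalGroup G]

/-- `x ∈ H²(G/N)` is the transgression of `χ : N → ℤ/m`, up to sign: the inflation to `G` of a
cocycle representing `x` is the negative of the coboundary of a continuous cochain `c` of `G`
extending `χ` in the sense that `c (g σ) = c g + χ σ` for `σ ∈ N`. -/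
def IsTransgression (N : Subgroup G) [N.Normal] (χ : N → ZMod m) (x : ContH2 m (G ⧸ N)) : Prop :=
  ∃ (f : contCocycles₂ m (G ⧸ N)) (c : C(G, ZMod m)), QuotientAddGroup.mk f = x ∧
    (∀ g h : G, f.1 ((g : G ⧸ N), (h : G ⧸ N)) = c (g * h) - c g - c h) ∧
    ∀ (g : G) (σ : N), c (g * σ) = c g + χ σ

namespace IsTransgression

variable {N : Subgroup G} [N.Normal] {χ χ' : N → ZMod m} {x x' : ContH2 m (G ⧸ N)}

theorem zero : IsTransgression N (0 : N → ZMod m) 0 :=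
  ⟨0, 0, rfl, by simp, by simp⟩

theorem add (h : IsTransgression N χ x) (h' : IsTransgression N χ' x') :
    IsTransgression N (χ + χ') (x + x') := by
  obtain ⟨f, c, rfl, h1, h2⟩ := h
  obtain ⟨f', c', rfl, h1', h2'⟩ := h'
  refine ⟨f + f', c + c', rfl, fun g h ↦ ?_, fun g σ ↦ ?_⟩
  · simp only [AddSubgroup.coe_add, ContinuousMap.add_apply, h1, h1']; ring
  · simp only [Pi.add_apply, ContinuousMap.add_apply, h2, h2']; ring

theorem neg (h : IsTransgression N χ x) : IsTransgression N (-χ) (-x) := by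
  obtain ⟨f, c, rfl, h1, h2⟩ := h
  refine ⟨-f, -c, rfl, fun g h ↦ ?_, fun g σ ↦ ?_⟩
  · simp only [NegMemClass.coe_neg, ContinuousMap.neg_apply, h1]; ring
  · simp only [Pi.neg_apply, ContinuousMap.neg_apply, h2]; ring

theorem sub (h : IsTransgression N χ x) (h' : IsTransgression N χ' x') :
    IsTransgression N (χ - χ') (x - x') := by
  simpa only [sub_eq_add_neg] using h.add h'.neg

theorem map_mul (h : IsTransgression N χ x) (σ τ : N) : χ (σ * τ) = χ σ + χ τ := by
  obtain ⟨f, c, -, -, h2⟩ := h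
  have e1 := h2 1 (σ * τ)
  have e2 := h2 (1 * σ) τ
  rw [h2 1 σ, mul_assoc] at e2
  rw [Subgroup.coe_mul] at e1
  linear_combination e2 - e1

theorem continuous (h : IsTransgression N χ x) : Continuous χ := by
  obtain ⟨f, c, -, -, h2⟩ := h
  have e : χ = fun σ : N ↦ c σ - c 1 := by
    funext σ
    have := h2 1 σ
    rw [one_mul] at this
    rw [this]; ring
  rw [e]; fun_prop

/-- A class whose transgression data are trivial on `M ≤ N` becomes trivial on `G/M`. -/
theorem inflation_eq_zero (h : IsTransgression N χ x) {M : Subgroup G} [M.Normal] (hM : M ≤ N)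
    (hχ : ∀ σ : N, (σ : G) ∈ M → χ σ = 0) : inflation m M N hM x = 0 := by
  obtain ⟨f, c, rfl, h1, h2⟩ := h
  -- Triviality of χ on M makes c constant on the cosets of M, so c descends to G/M and, up to sign,
  -- bounds the inflated cocycle.
  have hc : ∀ a b : G, (QuotientGroup.leftRel M) a b → c a = c b := by
    intro a b hab
    have hab := QuotientGroup.leftRel_apply.1 hab
    have := h2 a ⟨a⁻¹ * b, hM hab⟩
    rw [hχ _ hab] at this
    simpa using this.symm
  let cbar : C(G ⧸ M, ZMod m) :=
    ⟨Quotient.lift c hc, Continuous.quotient_lift c.continuous hc⟩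
  refine (QuotientAddGroup.eq_zero_iff _).2 ⟨-cbar, ?_⟩
  ext ⟨a, b⟩
  induction a using QuotientGroup.induction_on with | H a => ?_
  induction b using QuotientGroup.induction_on with | H b => ?_
  have := h1 a b
  change -c b - -c (a * b) + -c a = f.1 ((a : G ⧸ N), (b : G ⧸ N))
  rw [this]; ring

/-- The case M = N of `inflation_eq_zero`, where inflation is the identity. -/
theorem eq_zero_right (h : IsTransgression N (0 : N → ZMod m) x) : x = 0 := by
  have h0 := h.inflation_eq_zero le_rfl fun _ _ ↦ rfl
  have hid : inflation m N N le_rfl x = x := by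
    induction x using QuotientAddGroup.induction_on with | H f => ?_
    refine congrArg QuotientAddGroup.mk ?_
    ext ⟨a, b⟩
    induction a using QuotientGroup.induction_on with | H a => ?_
    induction b using QuotientGroup.induction_on with | H b => ?_
    rfl
  rw [← hid, h0]

theorem right_unique (h : IsTransgression N χ x) (h' : IsTransgression N χ x') : x = x' := by
  have := h.sub h'
  rw [sub_self] at this
  exact sub_eq_zero.1 this.eq_zero_right

/-- When the cocycle is ∂b, adding the inflation of b to c gives a homomorphism on G, which vanishes
on N by `hN`. Since b is constant on N, so is c, and hence χ = 0. -/
theorem eq_zero_left (h : IsTransgression N χ 0)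
    (hN : ∀ c : C(G, ZMod m), (∀ a b, c (a * b) = c a + c b) → ∀ σ ∈ N, c σ = 0) : χ = 0 := by
  obtain ⟨f, c, hf, h1, h2⟩ := h
  obtain ⟨b, rfl⟩ := (QuotientAddGroup.eq_zero_iff f).1 hf
  let c' : C(G, ZMod m) := c + b.comp ⟨((↑) : G → G ⧸ N), QuotientGroup.continuous_mk⟩
  have hc' : ∀ g, c' g = c g + b (g : G ⧸ N) := fun _ ↦ rfl
  have hmul : ∀ x y, c' (x * y) = c' x + c' y := by
    intro x y
    have e : b (y : G ⧸ N) - b ((x : G ⧸ N) * (y : G ⧸ N)) + b (x : G ⧸ N) =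
      c (x * y) - c x - c y := h1 x y
    rw [hc', hc', hc', QuotientGroup.mk_mul]
    linear_combination -e
  funext σ
  have e1 := hN c' hmul σ σ.2
  have e2 := hN c' hmul 1 N.one_mem
  have e3 : ((σ : G) : G ⧸ N) = ((1 : G) : G ⧸ N) := by simp
  rw [hc'] at e1 e2
  rw [e3] at e1
  have := h2 1 σ
  rw [one_mul] at this
  simp only [Pi.zero_apply]
  linear_combination e1 - e2 - this

theorem left_unique (h : IsTransgression N χ x) (h' : IsTransgression N χ' x)
    (hN : ∀ c : C(G, ZMod m), (∀ a b, c (a * b) = c a + c b) → ∀ σ ∈ N, c σ = 0) : χ = χ' := by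
  have := h.sub h'
  rw [sub_self] at this
  exact sub_eq_zero.1 (this.eq_zero_left hN)

end IsTransgression

/-- Cocycles are not normalized, so f(1, 1) has to be carried along. -/
theorem cocycle_apply_one_right {H : Type*} [Group H] [TopologicalSpace H]
    (f : contCocycles₂ m H) (x : H) : f.1 (x, 1) = f.1 (1, 1) := by
  have := f.2 x 1 1
  simp only [mul_one] at this
  linear_combination -this

/-- A class of `H²(G/N)` which becomes trivial on `G/M` is a transgression of a function on `N`
which is trivial on `M`. -/
theorem exists_isTransgression_of_inflation_eq_zero {M N : Subgroup G} [M.Normal] [N.Normal]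
    (hM : M ≤ N) {x : ContH2 m (G ⧸ N)} (hx : inflation m M N hM x = 0) :
    ∃ χ : N → ZMod m, IsTransgression N χ x ∧ ∀ σ : N, (σ : G) ∈ M → χ σ = 0 := by
  induction x using QuotientAddGroup.induction_on with | H f => ?_
  obtain ⟨b, hb⟩ := (QuotientAddGroup.eq_zero_iff (contCocyclesMap m (quotientProj M N hM) f)).1 hx
  have hb' : ∀ g h : G, b (h : G ⧸ M) - b ((g * h : G) : G ⧸ M) + b (g : G ⧸ M) =
      f.1 ((g : G ⧸ N), (h : G ⧸ N)) := fun g h ↦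
    congrArg (fun F : contCocycles₂ m (G ⧸ M) ↦ F.1 ((g : G ⧸ M), (h : G ⧸ M))) hb
  -- The cochain is c = -b, which forces χ(σ) = c(σ) - c(1); the term b(1) = f(1, 1) need not
  -- vanish.
  refine ⟨fun σ ↦ b ((1 : G) : G ⧸ M) - b ((σ : G) : G ⧸ M), ⟨f,
    -b.comp ⟨((↑) : G → G ⧸ M), QuotientGroup.continuous_mk⟩, rfl, fun g h ↦ ?_,
      fun g σ ↦ ?_⟩, fun σ hσ ↦ ?_⟩
  · change _ = -b ((g * h : G) : G ⧸ M) - -b (g : G ⧸ M) - -b (h : G ⧸ M)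
    rw [← hb']; ring
  · change -b ((g * σ : G) : G ⧸ M) = -b (g : G ⧸ M) + _
    have e1 := hb' g σ
    have e2 := hb' 1 1
    have e3 : ((σ : G) : G ⧸ N) = 1 := by simp
    rw [e3, cocycle_apply_one_right] at e1
    rw [mul_one, QuotientGroup.mk_one N] at e2
    linear_combination e1 - e2
  · have e : ((σ : G) : G ⧸ M) = ((1 : G) : G ⧸ M) := by simpa using hσ
    change b _ - b ((σ : G) : G ⧸ M) = 0
    rw [e, sub_self]

end Transgression

/-! ### Liftings and transgression -/

section Restrictions

variable {m : ℕ} {G : Type*} [Group G] [TopologicalSpace G]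

/-- The functions `N → ℤ/m` obtained by restricting continuous homomorphisms `G → U_ω`. -/
def liftingRestrictions (Ω : Set (ProfiniteCentralExtension.{u} m)) (N : Subgroup G) :
    Set (N → ZMod m) :=
  {χ | ∃ ω ∈ Ω, ∃ ρ : G →ₜ* ω.U, ∀ σ : N, ω.ι (Multiplicative.ofAdd (χ σ)) = ρ σ}

variable {Ω : Set (ProfiniteCentralExtension.{u} m)}

theorem mem_subgroupTbar_iff {g : G} :
    g ∈ subgroupTbar Ω G ↔ ∀ ω ∈ Ω, ∀ ρ : G →ₜ* ω.Ubar, ρ g = 1 := by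
  simp [subgroupTbar, kernelIntersection, Subgroup.mem_iInf, MonoidHom.mem_ker]

theorem mem_subgroupT_iff {g : G} :
    g ∈ subgroupT Ω G ↔ ∀ ω ∈ Ω, ∀ ρ : G →ₜ* ω.U, ρ g = 1 := by
  simp [subgroupT, kernelIntersection, Subgroup.mem_iInf, MonoidHom.mem_ker]

/-- If `ℤ/m` embeds in some `Ubar_ω`, then homomorphisms `G → ℤ/m` vanish on `Tbar(G)`. -/
theorem apply_eq_zero_of_mem_subgroupTbar {ω : ProfiniteCentralExtension.{u} m} (hω : ω ∈ Ω)
    (hj : ω.KernelEmbeds) (c : C(G, ZMod m)) (hc : ∀ a b, c (a * b) = c a + c b) {σ : G}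
    (hσ : σ ∈ subgroupTbar Ω G) : c σ = 0 := by
  obtain ⟨j, hj⟩ := hj
  have : DiscreteTopology (Multiplicative (ZMod m)) :=
    inferInstanceAs (DiscreteTopology (ZMod m))
  let φ : G →ₜ* ω.Ubar :=
    { toMonoidHom := j.comp (MonoidHom.mk' (fun g ↦ Multiplicative.ofAdd (c g)) hc)
      continuous_toFun := (continuous_of_discreteTopology (f := j)).comp
        (continuous_ofAdd.comp c.continuous) }
  have h1 : j (Multiplicative.ofAdd (c σ)) = 1 := mem_subgroupTbar_iff.1 hσ ω hω φ
  exact Multiplicative.ofAdd.injective (hj (h1.trans (map_one j).symm))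

theorem continuous_of_mem_liftingRestrictions [NeZero m] {N : Subgroup G} {χ : N → ZMod m}
    (hχ : χ ∈ liftingRestrictions Ω N) : Continuous χ := by
  obtain ⟨ω, -, ρ, hρ⟩ := hχ
  have h : Continuous fun σ : N ↦ Multiplicative.ofAdd (χ σ) := by
    refine ω.isClosedEmbedding_ι.isInducing.continuous_iff.2 ?_
    have e : (ω.ι ∘ fun σ : N ↦ Multiplicative.ofAdd (χ σ)) = fun σ : N ↦ ρ σ := funext hρ
    rw [e]; fun_prop
  exact continuous_toAdd.comp h

/-- Every continuous homomorphism `G → U_ω` is a lifting if `N ≤ Tbar(G)`. -/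
theorem exists_isLifting {N : Subgroup G} [N.Normal]
    (hN : N ≤ subgroupTbar Ω G) {ω : ProfiniteCentralExtension.{u} m} (hω : ω ∈ Ω)
    (ρ : G →ₜ* ω.U) : ∃ ρbar : G ⧸ N →ₜ* ω.Ubar, IsLifting N ω ρbar ρ :=
  ⟨{ toMonoidHom := QuotientGroup.lift N (ω.lam.comp ρ).toMonoidHom fun _ hσ ↦
        mem_subgroupTbar_iff.1 (hN hσ) ω hω (ω.lam.comp ρ)
     continuous_toFun := (QuotientGroup.isQuotientMap_mk (N := N)).continuous_iff.2
        (ω.lam.comp ρ).continuous_toFun }, fun _ ↦ rfl⟩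

end Restrictions

section Lifting

variable {m : ℕ} {G : Type*} [Group G] [TopologicalSpace G] [IsTopologicalGroup G]

/-- For a continuous section s, both ρ and s ∘ ρbar ∘ π lift ρbar ∘ π. Their quotient is a central
cochain c, and multiplicativity of ρ expresses the pulled-back factor set through c. -/
theorem IsLifting.exists_isTransgression [NeZero m] {N : Subgroup G} [N.Normal]
    {ω : ProfiniteCentralExtension.{u} m} {ρbar : G ⧸ N →ₜ* ω.Ubar} {ρ : G →ₜ* ω.U}
    (h : IsLifting N ω ρbar ρ) :
    ∃ χ : N → ZMod m, (∀ σ : N, ω.ι (Multiplicative.ofAdd (χ σ)) = ρ σ) ∧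
      IsTransgression N χ (ContH2.map m ρbar ω.alpha) := by
  obtain ⟨f, s, hs, hmul⟩ := ω.exists_isFactorSet
  rw [ω.alpha_eq ⟨hs, hmul⟩]
  have hc : ∀ g : G, ∃ z, ω.ι z = ρ g * (s (ρbar (g : G ⧸ N)))⁻¹ := fun g ↦
    ω.exists_ι_of_lam_eq_one (by rw [map_mul, map_inv, hs, h g, mul_inv_cancel])
  choose c hc using hc
  have hcont : Continuous c := by
    refine ω.isClosedEmbedding_ι.isInducing.continuous_iff.2 ?_
    have e : ω.ι ∘ c = fun g : G ↦ ρ g * (s (ρbar (g : G ⧸ N)))⁻¹ := funext hc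
    have hπ : Continuous ((↑) : G → G ⧸ N) := QuotientGroup.continuous_mk
    rw [e]; fun_prop
  have hρ : ∀ g, ρ g = ω.ι (c g) * s (ρbar (g : G ⧸ N)) := fun g ↦ by rw [hc]; group
  -- The section need not satisfy s(1) = 1; comparing with ρ(1) = 1 shows s(1) = ι(c 1)⁻¹.
  have hχ : ∀ σ : N, ω.ι (c σ * (c 1)⁻¹) = ρ σ := by
    intro σ
    have e1 := hρ σ
    have e2 := hρ 1
    have e3 : ((σ : G) : G ⧸ N) = ((1 : G) : G ⧸ N) := by simp
    rw [e3] at e1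
    rw [map_one] at e2
    rw [e1, eq_inv_of_mul_eq_one_right e2.symm, map_mul, map_inv]
  refine ⟨fun σ ↦ (c σ * (c 1)⁻¹).toAdd, hχ, contCocyclesMap m ρbar f,
    ⟨fun g ↦ (c g).toAdd, continuous_toAdd.comp hcont⟩, rfl, fun x y ↦ ?_, fun g σ ↦ ?_⟩
  · have key : c x * c y * .ofAdd (f.1 (ρbar x, ρbar y)) = c (x * y) := by
      apply ω.ι_injective
      apply mul_right_cancel (b := s (ρbar x * ρbar y))
      have e := hρ (x * y)
      rw [QuotientGroup.mk_mul, map_mul, map_mul] at e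
      rw [← e, hρ x, hρ y, map_mul, map_mul, mul_assoc _ _ (s _), ← hmul, mul_assoc (ω.ι (c x)),
        mul_assoc (ω.ι (c x)), ← mul_assoc (s (ρbar x)), ω.commute_ι]
      simp only [mul_assoc]
    have key' := congrArg Multiplicative.toAdd key
    simp only [toAdd_mul, toAdd_ofAdd] at key'
    change f.1 (ρbar x, ρbar y) = (c (x * y)).toAdd - (c x).toAdd - (c y).toAdd
    linear_combination key'
  · have key : c (g * σ) = c g * (c σ * (c 1)⁻¹) := by
      apply ω.ι_injective
      apply mul_right_cancel (b := s (ρbar (g : G ⧸ N)))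
      have e := hρ (g * σ)
      have e3 : ((g * σ : G) : G ⧸ N) = (g : G ⧸ N) := by simp
      rw [e3] at e
      rw [← e, map_mul, map_mul ω.ι, hχ, hρ g, ← hχ, mul_assoc, mul_assoc, ω.commute_ι]
    exact (congrArg Multiplicative.toAdd key).trans (toAdd_mul _ _)

variable {Ω : Set (ProfiniteCentralExtension.{u} m)} {N : Subgroup G} [N.Normal]

variable [NeZero m]

theorem exists_isTransgression_of_mem_liftingRestrictions (hN : N ≤ subgroupTbar Ω G)
    {χ : N → ZMod m} (hχ : χ ∈ liftingRestrictions Ω N) :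
    ∃ x ∈ liftablePart Ω N, IsTransgression N χ x := by
  obtain ⟨ω, hω, ρ, hρ⟩ := hχ
  obtain ⟨ρbar, hl⟩ := exists_isLifting hN hω ρ
  obtain ⟨χ', hχ', ht⟩ := hl.exists_isTransgression
  have e : χ = χ' := funext fun σ ↦
    Multiplicative.ofAdd.injective (ω.ι_injective ((hρ σ).trans (hχ' σ).symm))
  exact ⟨_, AddSubgroup.subset_closure ⟨ω, hω, ρbar, ⟨ρ, hl⟩, rfl⟩, e ▸ ht⟩

theorem exists_isTransgression_of_mem_closure (hN : N ≤ subgroupTbar Ω G)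
    {χ : N → ZMod m} (hχ : χ ∈ AddSubgroup.closure (liftingRestrictions Ω N)) :
    ∃ x ∈ liftablePart Ω N, IsTransgression N χ x := by
  induction hχ using AddSubgroup.closure_induction with
  | mem χ h => exact exists_isTransgression_of_mem_liftingRestrictions hN h
  | zero => exact ⟨0, zero_mem _, .zero⟩
  | add χ χ' _ _ h h' =>
    obtain ⟨x, hx, h⟩ := h
    obtain ⟨x', hx', h'⟩ := h'
    exact ⟨x + x', add_mem hx hx', h.add h'⟩
  | neg χ _ h =>
    obtain ⟨x, hx, h⟩ := h
    exact ⟨-x, neg_mem hx, h.neg⟩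

/-- Elements of `H²(G/N)_π` are transgressions of functions on `N` trivial on `N ∩ T(G)`. -/
theorem exists_isTransgression_of_mem_liftablePart {x : ContH2 m (G ⧸ N)}
    (hx : x ∈ liftablePart Ω N) : ∃ χ : N → ZMod m, IsTransgression N χ x ∧
      ∀ σ : N, (σ : G) ∈ N ⊓ subgroupT Ω G → χ σ = 0 := by
  induction hx using AddSubgroup.closure_induction with
  | mem x h =>
    obtain ⟨ω, hω, ρbar, ⟨ρ, hl⟩, rfl⟩ := h
    obtain ⟨χ, hχ, ht⟩ := hl.exists_isTransgression
    refine ⟨χ, ht, fun σ hσ ↦ ?_⟩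
    have h1 := hχ σ
    rw [mem_subgroupT_iff.1 hσ.2 ω hω ρ] at h1
    exact Multiplicative.ofAdd.injective (ω.ι_injective (h1.trans (map_one ω.ι).symm))
  | zero => exact ⟨0, .zero, fun _ _ ↦ rfl⟩
  | add x x' _ _ h h' =>
    obtain ⟨χ, h, h0⟩ := h
    obtain ⟨χ', h', h0'⟩ := h'
    exact ⟨χ + χ', h.add h', fun σ hσ ↦ by simp [h0 σ hσ, h0' σ hσ]⟩
  | neg x _ h =>
    obtain ⟨χ, h, h0⟩ := h
    exact ⟨-χ, h.neg, fun σ hσ ↦ by simp [h0 σ hσ]⟩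

end Lifting

/-! ### Duality for compact groups of prime exponent -/

section Duality

variable {p : ℕ} [Fact p.Prime] {N : Type*} [Group N]

/-- The common kernel of the r i lies in that of χ, so χ factors through the image of N in 𝔽_p^ι.
Extending the resulting functional to 𝔽_p^ι writes χ as a combination of the coordinates r i. -/
theorem mem_closure_range_of_forall_eq_zero {ι : Type*} [Fintype ι] (r : ι → N → ZMod p)
    (hr : ∀ i a b, r i (a * b) = r i a + r i b) (χ : N → ZMod p)
    (hχ : ∀ a b, χ (a * b) = χ a + χ b) (h : ∀ σ, (∀ i, r i σ = 0) → χ σ = 0) :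
    χ ∈ AddSubgroup.closure (Set.range r) := by
  classical
  let Φ : Additive N →+ (ι → ZMod p) :=
    AddMonoidHom.mk' (fun a i ↦ r i a.toMul) fun a b ↦ funext fun i ↦ hr i _ _
  let X : Additive N →+ ZMod p := AddMonoidHom.mk' (fun a ↦ χ a.toMul) fun a b ↦ hχ _ _
  have hker : Φ.rangeRestrict.ker ≤ X.ker := by
    intro a ha
    rw [AddMonoidHom.ker_rangeRestrict] at ha
    exact h a.toMul fun i ↦ congrFun ((AddMonoidHom.mem_ker).1 ha) i
  let L : Φ.range →+ ZMod p :=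
    AddMonoidHom.liftOfSurjective Φ.rangeRestrict Φ.rangeRestrict_surjective ⟨X, hker⟩
  have hL : ∀ a, L (Φ.rangeRestrict a) = X a := fun a ↦
    AddMonoidHom.liftOfRightInverse_comp_apply _ _ _ ⟨X, hker⟩ a
  let W : Submodule (ZMod p) (ι → ZMod p) := AddSubgroup.toZModSubmodule p Φ.range
  let L' : W →ₗ[ZMod p] ZMod p := AddMonoidHom.toZModLinearMap p (M := W) L
  -- Primality enters here: over a field a functional on a subspace extends to the whole space.
  obtain ⟨E, hE⟩ := L'.exists_extend
  have hE' : ∀ σ : N, χ σ = ∑ i, r i σ * E (Pi.single i 1) := by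
    intro σ
    have h1 : E (Φ (Additive.ofMul σ)) = χ σ :=
      (LinearMap.congr_fun hE (Φ.rangeRestrict (Additive.ofMul σ))).trans (hL _)
    rw [← h1, LinearMap.pi_apply_eq_sum_univ E]
    refine Finset.sum_congr rfl fun i _ ↦ ?_
    have hs : (fun j ↦ if i = j then (1 : ZMod p) else 0) = Pi.single i 1 := by
      funext j
      simp [Pi.single_apply, eq_comm]
    rw [hs]
    rfl
  have e : χ = ∑ i, (E (Pi.single i 1)).val • r i := by
    funext σ
    rw [hE', Finset.sum_apply]
    refine Finset.sum_congr rfl fun i _ ↦ ?_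
    rw [Pi.smul_apply, nsmul_eq_mul, ZMod.natCast_val, ZMod.cast_id, mul_comm]
  rw [e]
  exact sum_mem fun i _ ↦ nsmul_mem (AddSubgroup.subset_closure (Set.mem_range_self i)) _

/-- The locus χ ≠ 0 is compact and misses the common zero set of R, hence already that of finitely
many members, which reduces to the finite case. -/
theorem mem_closure_of_forall_eq_zero [TopologicalSpace N] [CompactSpace N]
    {R : Set (N → ZMod p)} (hRc : ∀ r ∈ R, Continuous r)
    (hR : ∀ r ∈ R, ∀ a b, r (a * b) = r a + r b) {χ : N → ZMod p} (hχc : Continuous χ)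
    (hχ : ∀ a b, χ (a * b) = χ a + χ b) (h : ∀ σ, (∀ r ∈ R, r σ = 0) → χ σ = 0) :
    χ ∈ AddSubgroup.closure R := by
  have hcomp : IsCompact (χ ⁻¹' {0}ᶜ) :=
    (IsClosed.preimage hχc (isClosed_discrete ({0}ᶜ : Set (ZMod p)))).isCompact
  obtain ⟨t, ht⟩ := hcomp.elim_finite_subfamily_closed (fun r : R ↦ r.1 ⁻¹' {0})
    (fun r ↦ IsClosed.preimage (hRc r r.2) (isClosed_discrete _)) (by
      ext σ
      simpa using fun h0 ↦ by simpa using mt (h σ) h0)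
  refine AddSubgroup.closure_mono ?_ (mem_closure_range_of_forall_eq_zero
    (fun r : t ↦ r.1.1) (fun r ↦ hR _ r.1.2) χ hχ fun σ hσ ↦ ?_)
  · rintro _ ⟨r, rfl⟩
    exact r.1.2
  · by_contra h0
    have hmem : σ ∈ χ ⁻¹' {0}ᶜ ∩ ⋂ r ∈ t, r.1 ⁻¹' {0} :=
      ⟨h0, Set.mem_iInter₂.2 fun r hr ↦ hσ ⟨r, hr⟩⟩
    rwa [ht] at hmem

end Duality

/-! ### The pairing and the exact sequence -/

theorem proposition6p4 (m : ℕ) [NeZero m] (hm : 2 ≤ m)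
    (Ω : Set (ProfiniteCentralExtension.{u} m)) (hΩ : Ω.Nonempty)
    (hI : ∀ ω ∈ Ω, ω.HasSeparatingHoms) (hII : ∀ ω ∈ Ω, ω.KernelEmbeds)
    {G : Type v} [Group G] [TopologicalSpace G] [IsTopologicalGroup G] [CompactSpace G]
    [TotallyDisconnectedSpace G]
    (N : Subgroup G) [N.Normal] (hNclosed : IsClosed (N : Set G)) (hN : N ≤ subgroupTbar Ω G) :
    (∃ β : N ⧸ (N ⊓ subgroupT Ω G).subgroupOf N → liftablePart Ω N → ZMod m,
      IsBilinearPairing β ∧ IsNondegeneratePairing β ∧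
      ∀ ω ∈ Ω, ∀ (ρbar : G ⧸ N →ₜ* ω.Ubar) (ρ : G →ₜ* ω.U), IsLifting N ω ρbar ρ →
        ∀ (σ : N) (x : liftablePart Ω N), (x : ContH2 m (G ⧸ N)) = ContH2.map m ρbar ω.alpha →
          ω.ι (Multiplicative.ofAdd (β (σ : N ⧸ (N ⊓ subgroupT Ω G).subgroupOf N) x)) = ρ σ) ∧
    (m.Prime →
      Function.Injective (liftablePart Ω N).subtype ∧
      Function.Exact (liftablePart Ω N).subtype
        (inflation m (N ⊓ subgroupT Ω G) N inf_le_left)) := by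
  obtain ⟨ω₀, hω₀⟩ := hΩ
  have hom : ∀ c : C(G, ZMod m), (∀ a b, c (a * b) = c a + c b) → ∀ σ ∈ N, c σ = 0 :=
    fun c hc σ hσ ↦ apply_eq_zero_of_mem_subgroupTbar hω₀ (hII ω₀ hω₀) c hc (hN hσ)
  refine ⟨?_, fun hp ↦ ⟨Subtype.val_injective, fun x ↦ ⟨fun hx ↦ ?_, ?_⟩⟩⟩
  -- The choice of χ x is forced by `left_unique`; this gives additivity in x and the value on
  -- ρbar^*(α_ω).
  · choose χ hχ hχ0 using fun x : liftablePart Ω N ↦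
      exists_isTransgression_of_mem_liftablePart x.2
    have hrel : ∀ x, ∀ a b : N,
        (QuotientGroup.leftRel ((N ⊓ subgroupT Ω G).subgroupOf N)) a b → χ x a = χ x b := by
      intro x a b hab
      have h0 := hχ0 x (a⁻¹ * b) (Subgroup.mem_subgroupOf.1 (QuotientGroup.leftRel_apply.1 hab))
      have h1 := (hχ x).map_mul a (a⁻¹ * b)
      rw [mul_inv_cancel_left, h0, add_zero] at h1
      exact h1.symm
    refine ⟨fun a x ↦ Quotient.lift (χ x) (hrel x) a, ⟨?_, ?_, ?_⟩, ⟨?_, ?_⟩, ?_⟩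
    · intro a b x
      induction a using QuotientGroup.induction_on with | H a => ?_
      induction b using QuotientGroup.induction_on with | H b => ?_
      exact (hχ x).map_mul a b
    · intro a x y
      induction a using QuotientGroup.induction_on with | H a => ?_
      exact congrFun ((hχ (x + y)).left_unique ((hχ x).add (hχ y)) hom) a
    · intro x
      exact Continuous.quotient_lift (hχ x).continuous _
    · intro a ha
      induction a using QuotientGroup.induction_on with | H σ => ?_
      refine (QuotientGroup.eq_one_iff σ).2 (Subgroup.mem_subgroupOf.2
        ⟨σ.2, mem_subgroupT_iff.2 fun ω hω ρ ↦ ?_⟩)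
      obtain ⟨ρbar, hl⟩ := exists_isLifting hN hω ρ
      obtain ⟨χ', hχ', ht⟩ := hl.exists_isTransgression
      let x : liftablePart Ω N :=
        ⟨_, AddSubgroup.subset_closure ⟨ω, hω, ρbar, ⟨ρ, hl⟩, rfl⟩⟩
      have h0 : χ x σ = 0 := ha x
      rw [(hχ x).left_unique ht hom] at h0
      rw [← hχ', h0, ofAdd_zero, map_one]
    · intro x hx
      have h0 : χ x = 0 := funext fun σ ↦ hx (σ : N ⧸ (N ⊓ subgroupT Ω G).subgroupOf N)
      exact Subtype.ext (h0 ▸ hχ x).eq_zero_right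
    · intro ω _ ρbar ρ hl σ x hx
      obtain ⟨χ', hχ', ht⟩ := hl.exists_isTransgression
      rw [← hx] at ht
      change ω.ι (Multiplicative.ofAdd (χ x σ)) = ρ σ
      rw [(hχ x).left_unique ht hom, hχ']
  · have : Fact m.Prime := ⟨hp⟩
    have : CompactSpace N := isCompact_iff_compactSpace.1 hNclosed.isCompact
    obtain ⟨χ, ht, h0⟩ := exists_isTransgression_of_inflation_eq_zero inf_le_left hx
    -- The common zero set in N of the restricted liftings is N ∩ T(G), where χ vanishes, so duality
    -- applies.
    have hmem : χ ∈ AddSubgroup.closure (liftingRestrictions Ω N) := by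
      refine mem_closure_of_forall_eq_zero
        (fun r hr ↦ continuous_of_mem_liftingRestrictions hr) (fun r hr ↦ ?_) ht.continuous
        ht.map_mul fun σ hσ ↦ h0 σ ⟨σ.2, mem_subgroupT_iff.2 fun ω hω ρ ↦ ?_⟩
      · obtain ⟨_, _, h⟩ := exists_isTransgression_of_mem_liftingRestrictions hN hr
        exact h.map_mul
      · obtain ⟨ρbar, hl⟩ := exists_isLifting hN hω ρ
        obtain ⟨χ', hχ', -⟩ := hl.exists_isTransgression
        rw [← hχ', hσ χ' ⟨ω, hω, ρ, hχ'⟩, ofAdd_zero, map_one]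
    -- A class in H²(G/N)_π with the same χ as x must equal x.
    obtain ⟨x', hx', ht'⟩ := exists_isTransgression_of_mem_closure hN hmem
    exact ⟨⟨x', hx'⟩, ht'.right_unique ht⟩
  · rintro ⟨x, rfl⟩
    obtain ⟨χ, ht, h0⟩ := exists_isTransgression_of_mem_liftablePart x.2
    exact ht.inflation_eq_zero inf_le_left h0
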